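/- Conventions. Groups are abstract (discrete) groups. Let $E$ be a Hausdorff locally convex real topological vector space with topological dual $E'$, and let $C\subseteq E$ be a convex cone (containing $0$) that is proper, i.e. $C\cap(-C)=\{0\}$, and weakly complete, i.e. complete for the uniform structure of the weak topology of $E$. A representation of a group $G$ on $C$ is an action of $G$ on $E$ by continuous linear maps that preserve $C$. It is of locally bounded type if some non-zero $x\in C$ has a bounded orbit $Gx$ (bounded in the sense of topological vector spaces: absorbed by every neighbourhood of zero). It is of cobounded type if there is $\varphi\in E'$ such that for every $\lambda\in E'$ there are $g_1,\dots,g_n\in G$ with $\pm\lambda\le\sum_{i=1}^n g_i\varphi$; here $G$ acts on $E'$ by $(g\varphi)(x)=\varphi(g^{-1}x)$, and $\lambda\le\psi$ means $\lambda(x)\le\psi(x)$ for all $x\in C$. A group $G$ has the fixed-point property for cones if for every such $E$ and $C$, every representation of $G$ on $C$ that is of locally bounded type and of cobounded type has a non-zero fixed point in $C$. A group $H$ is subexponential if $\lim_{n\to\infty}|S^n|^{1/n}=1$ for every non-empty finite subset $S\subseteq H$, where $S^n$ is the set of $n$-fold products of elements of $S$. Theorem. The class of groups with the fixed-point property for cones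 is closed under the following operations. (0) Quotients: if $G$ has the property and $G\to Q$ is a surjective homomorphism, then $Q$ has the property. (1) Subgroups: if $G$ has the property, so does every subgroup of $G$. (2) Directed unions: if $G$ is the union of a family of subgroups that is directed with respect to inclusion and each of these subgroups has the property, then $G$ has the property. (3) Cartesian products with subexponential groups: if $G$ has the property and $H$ is subexponential, then $G\times H$ has the property. (4) Central extensions: if $1\to N\to G\to Q\to 1$ is an exact sequence of groups, the image of $N$ is contained in the centre of $G$, and $Q$ has the property, then $G$ has the property. (5) Extensions by and of finite groups: let $1\to N\to G\to Q\to 1$ be an exact sequence of groups. If $N$ is finite and $Q$ has the property, then $G$ has the property; if $Q$ is finite and $N$ has the property, then $G$ has the property. -/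

import Mathlib

open Filter Topology
open scoped Pointwise

universe u

section Cones

variable {G : Type*} [Group G] {E : Type*} [AddCommGroup E] [Module ℝ E] [TopologicalSpace E]

/-- The dual pre-order on the topological dual `E'` of `E` induced by the cone `C`:
`φ ≤ ψ` when `φ x ≤ ψ x` for every `x` in `C`. -/
def DualLE (C : PointedCone ℝ E) (φ ψ : StrongDual ℝ E) : Prop :=
  ∀ x ∈ C, φ x ≤ ψ x

/-- The dual action on the topological dual: `(g φ) x = φ (g⁻¹ x)`. -/
def dualAct (ρ : G →* (E →L[ℝ] E)) (g : G) (φ : StrongDual ℝ E) : StrongDual ℝ E :=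
  φ.comp (ρ g⁻¹)

/-- `φ` `G`-dominates `l` in `E'`: there are `g₁, …, gₙ` in `G` with
`l ≤ ∑ gᵢ φ` and `-l ≤ ∑ gᵢ φ` in the dual pre-order. -/
def GDominates [IsTopologicalAddGroup E] (C : PointedCone ℝ E) (ρ : G →* (E →L[ℝ] E))
    (φ l : StrongDual ℝ E) : Prop :=
  ∃ (n : ℕ) (g : Fin n → G),
    DualLE C l (∑ i, dualAct ρ (g i) φ) ∧ DualLE C (-l) (∑ i, dualAct ρ (g i) φ)

/-- Locally bounded type: some non-zero point of the cone has a bounded orbit. -/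
def IsLocallyBoundedType (C : PointedCone ℝ E) (ρ : G →* (E →L[ℝ] E)) : Prop :=
  ∃ x ∈ C, x ≠ 0 ∧ Bornology.IsVonNBounded ℝ (Set.range fun g : G => ρ g x)

/-- Cobounded type: some continuous linear form `G`-dominates all continuous linear forms. -/
def IsCoboundedType [IsTopologicalAddGroup E] (C : PointedCone ℝ E)
    (ρ : G →* (E →L[ℝ] E)) : Prop :=
  ∃ φ : StrongDual ℝ E, ∀ l : StrongDual ℝ E, GDominates C ρ φ l

/-- A subset of `E` is weakly complete if it is complete for the (translation-invariant)
uniform structure of the weak topology of `E`. -/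
def IsWeaklyComplete (s : Set E) [IsTopologicalAddGroup E] : Prop :=
  @IsComplete (WeakSpace ℝ E) (IsTopologicalAddGroup.rightUniformSpace (WeakSpace ℝ E))
    (toWeakSpace ℝ E '' s)

end Cones

/-- The fixed-point property for cones: every representation of `G` by continuous linear maps on
a Hausdorff locally convex space `E` that preserves a weakly complete proper convex cone `C`
(proper: `C ∩ (-C) = {0}`, Mathlib's `Salient`), and that is of locally bounded and of cobounded
type, has a non-zero fixed point in `C`. -/
def FixedPointPropertyForCones (G : Type u) [Group G] : Prop :=
  ∀ (E : Type u) [AddCommGroup E] [Module ℝ E] [TopologicalSpace E] [IsTopologicalAddGroup E]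
    [ContinuousSMul ℝ E] [LocallyConvexSpace ℝ E] [T2Space E]
    (C : PointedCone ℝ E) (ρ : G →* (E →L[ℝ] E)),
    (∀ (g : G), ∀ x ∈ C, ρ g x ∈ C) →
    (C : ConvexCone ℝ E).Salient →
    IsWeaklyComplete (C : Set E) →
    IsLocallyBoundedType C ρ →
    IsCoboundedType C ρ →
    ∃ x ∈ C, x ≠ 0 ∧ ∀ g : G, ρ g x = x

/-- `G` is subexponential: `|Sⁿ|^(1/n) → 1` for every non-empty finite subset `S`, where `Sⁿ` is
the set of `n`-fold products of elements of `S`. -/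
def IsSubexponentialGroup (G : Type*) [Group G] : Prop :=
  ∀ S : Finset G, S.Nonempty →
    Tendsto (fun n : ℕ => ((((S : Set G) ^ n).ncard : ℕ) : ℝ) ^ (1 / (n : ℝ))) atTop (𝓝 1)

/-! By duality the property concerns functionals only. A point of a weakly complete cone `C` is the
same thing as a functional on `E'` that is non-negative on the dual cone
(`IsWeaklyComplete.exists_eval_eq`), so a fixed point is an invariant positive functional.
Conversely, the positive functionals on an ordered representation form a weakly complete cone for
pointwise convergence. Hence the property is equivalent to `HasInvariantStates`, where no topology
is left. The slightly stronger `exists_isInvariantState` says that if a quotient of `Γ` has the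
property, it suffices to find a bounded state invariant under the kernel.

The closure properties then amount to producing bounded states: pull back (quotients), induce
functions on the larger group (subgroups), take ultrafilter limits (directed unions), sum over a
finite kernel or finite quotient. Products and central extensions share one argument. Averages `∑ qⁿ
∑_{h ∈ Sⁿ}` of a bounded state converge for `q < 1` when growth is subexponential, and translating
by `s ∈ S` costs at most a factor `q⁻¹`. As `S` grows and `q → 1`, a limit is invariant. It remains
a bounded state because each average can first be moved by an element of a commuting subgroup, which
makes it almost maximal at `φ`. -/

/-! ### Weakly complete cones and positive functionals on the dual -/

section WeakCompleteness

variable {E : Type*} [AddCommGroup E] [Module ℝ E] [TopologicalSpace E] [IsTopologicalAddGroup E]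

/-- A set is weakly complete if and only if its image in the product `ℝ ^ E'` is closed. -/
theorem isWeaklyComplete_iff_isClosed (s : Set E) :
    IsWeaklyComplete s ↔ IsClosed ((fun (x : E) (l : StrongDual ℝ E) => l x) '' s) := by
  let _ : UniformSpace (WeakSpace ℝ E) := IsTopologicalAddGroup.rightUniformSpace (WeakSpace ℝ E)
  have : IsUniformAddGroup (WeakSpace ℝ E) := isUniformAddGroup_of_addCommGroup
  let f : WeakSpace ℝ E →+ (StrongDual ℝ E → ℝ) :=
    { toFun := fun x l => l ((toWeakSpace ℝ E).symm x)
      map_zero' := by ext; simp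
      map_add' := by intros; ext; simp }
  have hf : IsInducing f := ⟨rfl⟩
  -- Completeness thus transfers to the image in a product of lines, which is complete and
  -- Hausdorff, so there it means closedness.
  have hu : IsUniformInducing f := AddMonoidHom.isUniformInducing_of_isInducing hf
  have key : (fun (x : E) (l : StrongDual ℝ E) => l x) '' s = f '' (toWeakSpace ℝ E '' s) := by
    rw [Set.image_image]
    rfl
  unfold IsWeaklyComplete
  rw [key]
  refine (hu.isComplete_iff).symm.trans ?_
  exact ⟨fun h => h.isClosed, fun h => h.isComplete⟩

/-- A linear functional on the topological dual that is non-negative on the functionals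
non-negative on a weakly complete convex cone is the evaluation at a point of the cone. -/
theorem IsWeaklyComplete.exists_eval_eq {C : PointedCone ℝ E} [ContinuousSMul ℝ E]
    (hC : IsWeaklyComplete (C : Set E)) (T : StrongDual ℝ E →ₗ[ℝ] ℝ)
    (hT : ∀ l : StrongDual ℝ E, (∀ x ∈ C, 0 ≤ l x) → 0 ≤ T l) : ∃ x ∈ C, ∀ l, l x = T l := by
  rw [isWeaklyComplete_iff_isClosed] at hC
  -- `WeakBilin B` is the algebraic dual of `E'` with pointwise convergence. The image of `C` is
  -- closed there, and a functional separating `T` from it is evaluation at some `l` in `E'`,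
  -- non-negative on `C`.
  let B : (StrongDual ℝ E →ₗ[ℝ] ℝ) →ₗ[ℝ] StrongDual ℝ E →ₗ[ℝ] ℝ := LinearMap.id
  let ev : E →ₗ[ℝ] WeakBilin B := (topDualPairing ℝ E).flip
  have hcl : IsClosed ((C.map ev : PointedCone ℝ (WeakBilin B)) : Set (WeakBilin B)) := by
    convert hC.preimage (WeakBilin.coeFn_continuous B) using 1
    ext S
    constructor
    · rintro ⟨x, hx, rfl⟩
      exact ⟨x, hx, rfl⟩
    · rintro ⟨x, hx, h⟩
      exact ⟨x, hx, LinearMap.ext fun l => congrFun h l⟩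
  let K : ProperCone ℝ (WeakBilin B) := ⟨C.map ev, hcl⟩
  by_contra hcon
  let T' : WeakBilin B := T
  have hTK : T' ∉ K := by
    rintro ⟨x, hx, h⟩
    exact hcon ⟨x, hx, fun l => LinearMap.congr_fun h l⟩
  obtain ⟨F, hF, hFT⟩ := ProperCone.hyperplane_separation_point (E := WeakBilin B) (x₀ := T') K hTK
  obtain ⟨l, rfl⟩ := LinearMap.dualEmbedding_surjective B F
  refine absurd (hT l fun x hx => hF (ev x) ⟨x, hx, rfl⟩) (not_le.2 hFT)

end WeakCompleteness

/-! ### Fixed points in cones versus invariant states -/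

section InvariantStates

/-- `v` is dominated by `φ`: both `v` and `-v` are bounded above, for the pre-order defined by the
cone `P`, by a finite sum of translates of `φ`. -/
def IsDominatedBy {Γ V : Type*} [Group Γ] [AddCommGroup V] [Module ℝ V] (ρ : Representation ℝ Γ V)
    (P : PointedCone ℝ V) (φ v : V) : Prop :=
  ∃ L : List Γ, (L.map fun g => ρ g φ).sum + v ∈ P ∧ (L.map fun g => ρ g φ).sum - v ∈ P

/-- A linear representation preserving a convex cone, with a positive vector whose translates
dominate all vectors. -/
structure IsDominatingSystem {Γ V : Type*} [Group Γ] [AddCommGroup V] [Module ℝ V]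
    (ρ : Representation ℝ Γ V) (P : PointedCone ℝ V) (φ : V) : Prop where
  map_mem : ∀ g, ∀ v ∈ P, ρ g v ∈ P
  mem : φ ∈ P
  dominated : ∀ v, IsDominatedBy ρ P φ v

/-- A positive linear functional, positive at `φ`, that is bounded on the orbit of `φ`. -/
structure IsBoundedState {Γ V : Type*} [Group Γ] [AddCommGroup V] [Module ℝ V]
    (ρ : Representation ℝ Γ V) (P : PointedCone ℝ V) (φ : V) (T : V →ₗ[ℝ] ℝ) : Prop where
  nonneg : ∀ v ∈ P, 0 ≤ T v
  pos : 0 < T φ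
  bounded : ∃ M, ∀ g, T (ρ g φ) ≤ M

/-- An invariant positive linear functional normalised at `φ`. -/
structure IsInvariantState {Γ V : Type*} [Group Γ] [AddCommGroup V] [Module ℝ V]
    (ρ : Representation ℝ Γ V) (P : PointedCone ℝ V) (φ : V) (T : V →ₗ[ℝ] ℝ) : Prop where
  nonneg : ∀ v ∈ P, 0 ≤ T v
  map_eq_one : T φ = 1
  invariant : ∀ g v, T (ρ g v) = T v

/-- The algebraic form of the fixed-point property for cones: every dominating system with a
bounded state has an invariant state. -/
def HasInvariantStates (Γ : Type u) [Group Γ] : Prop :=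
  ∀ (V : Type u) [AddCommGroup V] [Module ℝ V] (ρ : Representation ℝ Γ V) (P : PointedCone ℝ V)
    (φ : V), IsDominatingSystem ρ P φ → (∃ T, IsBoundedState ρ P φ T) →
    ∃ T, IsInvariantState ρ P φ T

section Basic

variable {Γ V : Type*} [Group Γ] [AddCommGroup V] [Module ℝ V] {ρ : Representation ℝ Γ V}
  {P : PointedCone ℝ V} {φ : V}

theorem abs_le_sum_of_mem {L : List Γ} {v : V}
    (h₁ : (L.map fun g => ρ g φ).sum + v ∈ P) (h₂ : (L.map fun g => ρ g φ).sum - v ∈ P)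
    {T : V →ₗ[ℝ] ℝ} (hT : ∀ v ∈ P, 0 ≤ T v) : |T v| ≤ (L.map fun g => T (ρ g φ)).sum := by
  have e : T (L.map fun g => ρ g φ).sum = (L.map fun g => T (ρ g φ)).sum := by
    rw [map_list_sum, List.map_map]
    rfl
  have h₁ := hT _ h₁
  have h₂ := hT _ h₂
  rw [map_add, e] at h₁
  rw [map_sub, e] at h₂
  rw [abs_le]
  constructor <;> linarith

theorem abs_le_length_mul_of_mem {L : List Γ} {v : V}
    (h₁ : (L.map fun g => ρ g φ).sum + v ∈ P) (h₂ : (L.map fun g => ρ g φ).sum - v ∈ P)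
    {T : V →ₗ[ℝ] ℝ} (hT : ∀ v ∈ P, 0 ≤ T v) {M : ℝ} (hM : ∀ g ∈ L, T (ρ g φ) ≤ M) :
    |T v| ≤ L.length * M := by
  refine (abs_le_sum_of_mem h₁ h₂ hT).trans ?_
  have := List.sum_le_card_nsmul (L.map fun g => T (ρ g φ)) M (by simpa using hM)
  simpa using this

theorem translate_mem (hP : ∀ g, ∀ v ∈ P, ρ g v ∈ P) (a : Γ) {L : List Γ} {v : V}
    (h₁ : (L.map fun g => ρ g φ).sum + v ∈ P) (h₂ : (L.map fun g => ρ g φ).sum - v ∈ P) :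
    ((L.map (a * ·)).map fun g => ρ g φ).sum + ρ a v ∈ P ∧
      ((L.map (a * ·)).map fun g => ρ g φ).sum - ρ a v ∈ P := by
  have e : ((L.map (a * ·)).map fun g => ρ g φ).sum = ρ a (L.map fun g => ρ g φ).sum := by
    rw [map_list_sum, List.map_map, List.map_map]
    simp [Function.comp_def]
  rw [e, ← map_add, ← map_sub]
  exact ⟨hP _ _ h₁, hP _ _ h₂⟩

theorem IsDominatedBy.exists_bound {v : V} (hv : IsDominatedBy ρ P φ v)
    (hP : ∀ g, ∀ v ∈ P, ρ g v ∈ P) {T : V →ₗ[ℝ] ℝ} (hT : ∀ v ∈ P, 0 ≤ T v) {M : ℝ}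
    (hM : ∀ g, T (ρ g φ) ≤ M) : ∃ c, ∀ g, |T (ρ g v)| ≤ c := by
  obtain ⟨L, h₁, h₂⟩ := hv
  refine ⟨L.length * M, fun g => ?_⟩
  obtain ⟨h₁, h₂⟩ := translate_mem hP g h₁ h₂
  simpa using abs_le_length_mul_of_mem h₁ h₂ hT fun g _ => hM g

end Basic

/-- The space of linear functionals on a representation that are invariant under a subgroup. -/
def invariantDual {Γ V : Type*} [Group Γ] [AddCommGroup V] [Module ℝ V]
    (ρ : Representation ℝ Γ V) (N : Subgroup Γ) : Submodule ℝ (V →ₗ[ℝ] ℝ) where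
  carrier := {T | ∀ n ∈ N, ∀ v, T (ρ n v) = T v}
  add_mem' {S T} hS hT n hn v := by simp [hS n hn v, hT n hn v]
  zero_mem' n hn v := by simp
  smul_mem' c T hT n hn v := by simp [hT n hn v]

/-- `invariantDual` as a type. -/
def InvariantDual {Γ V : Type*} [Group Γ] [AddCommGroup V] [Module ℝ V]
    (ρ : Representation ℝ Γ V) (N : Subgroup Γ) := ↥(invariantDual ρ N)

instance {Γ V : Type*} [Group Γ] [AddCommGroup V] [Module ℝ V]
    (ρ : Representation ℝ Γ V) (N : Subgroup Γ) : AddCommGroup (InvariantDual ρ N) :=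
  inferInstanceAs (AddCommGroup (invariantDual ρ N))

instance {Γ V : Type*} [Group Γ] [AddCommGroup V] [Module ℝ V]
    (ρ : Representation ℝ Γ V) (N : Subgroup Γ) : Module ℝ (InvariantDual ρ N) :=
  inferInstanceAs (Module ℝ (invariantDual ρ N))

/-- A group with the fixed-point property for cones has invariant states; more generally, if `G` is
a quotient of `Γ`, then a bounded state invariant under the kernel yields a `Γ`-invariant state. -/
theorem FixedPointPropertyForCones.exists_isInvariantState {Γ G V : Type u} [Group Γ] [Group G]
    (hG : FixedPointPropertyForCones G) (π : Γ →* G) (hπ : Function.Surjective π)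
    [AddCommGroup V] [Module ℝ V] {ρ : Representation ℝ Γ V} {P : PointedCone ℝ V} {φ : V}
    (hS : IsDominatingSystem ρ P φ) {T₀ : V →ₗ[ℝ] ℝ} (hT₀ : IsBoundedState ρ P φ T₀)
    (hinv : ∀ n ∈ π.ker, ∀ v, T₀ (ρ n v) = T₀ v) : ∃ T, IsInvariantState ρ P φ T := by
  let D := InvariantDual ρ π.ker
  have hD : ∀ T : D, ∀ {a b : Γ} (_ : π a = π b) (v : V), T.1 (ρ a v) = T.1 (ρ b v) := by
    intro T a b hab v
    have h := T.2 (a * b⁻¹) (by simp [MonoidHom.mem_ker, hab]) (ρ b v)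
    rwa [← Module.End.mul_apply, ← map_mul, inv_mul_cancel_right] at h
  let B : D →ₗ[ℝ] V →ₗ[ℝ] ℝ := (invariantDual ρ π.ker).subtype
  have hB : Function.Injective B := (invariantDual ρ π.ker).injective_subtype
  let s : G → Γ := Function.surjInv hπ
  have hs : ∀ g, π (s g) = g := Function.surjInv_eq hπ
  -- The dual action of `Γ` on kernel-invariant functionals descends to `G`: by `hD` the choice of
  -- the lift `s g⁻¹` does not matter.
  let act (g : G) : WeakBilin B →L[ℝ] WeakBilin B :=
    { toFun := fun T : D => (⟨T.1 ∘ₗ ρ (s g⁻¹), fun n hn v => by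
        have := hD T (a := s g⁻¹ * n) (b := s g⁻¹) (by simp [MonoidHom.mem_ker.1 hn]) v
        simpa using this⟩ : D)
      map_add' := fun S T => rfl
      map_smul' := fun c T => rfl
      cont := WeakBilin.continuous_of_continuous_eval B fun v =>
        WeakBilin.eval_continuous B (ρ (s g⁻¹) v) }
  have hact : ∀ (g : Γ) (T : D) (v : V), (act (π g) T : D).1 v = T.1 (ρ g⁻¹ v) := fun g T v =>
    hD T (by simp [hs]) v
  let σ : G →* (WeakBilin B →L[ℝ] WeakBilin B) :=
    { toFun := act
      map_one' := by
        ext T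
        refine Subtype.ext (LinearMap.ext fun v => ?_)
        have := hact 1 T v
        simpa using this
      map_mul' := fun g h => by
        obtain ⟨g, rfl⟩ := hπ g
        obtain ⟨h, rfl⟩ := hπ h
        ext T
        refine Subtype.ext (LinearMap.ext fun v => ?_)
        have e₁ := hact (g * h) T v
        have e₂ := hact g (act (π h) T) v
        rw [hact h T] at e₂
        rw [← map_mul, e₁]
        refine Eq.trans ?_ e₂.symm
        simp }
  let C : PointedCone ℝ (WeakBilin B) :=
    { carrier := {T : D | ∀ v ∈ P, 0 ≤ T.1 v}
      add_mem' := fun {S T} hS hT v hv => add_nonneg (hS v hv) (hT v hv)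
      zero_mem' := fun v hv => le_rfl
      smul_mem' := fun c T hT v hv => mul_nonneg c.2 (hT v hv) }
  have : T2Space (WeakBilin B) := (WeakBilin.isEmbedding hB).t2Space
  -- Translates of `φ` control every vector, so they detect whether a positive functional vanishes.
  -- This gives properness of the cone and positivity at `φ` of the fixed point.
  have hzero : ∀ T : V →ₗ[ℝ] ℝ, (∀ v ∈ P, 0 ≤ T v) → (∀ g, T (ρ g φ) ≤ 0) → T = 0 := by
    intro T hT h
    ext v
    obtain ⟨L, h₁, h₂⟩ := hS.dominated v
    have := abs_le_length_mul_of_mem h₁ h₂ hT fun g _ => h g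
    simpa using this
  obtain ⟨M, hM⟩ := hT₀.bounded
  suffices h : ∃ T ∈ C, T ≠ 0 ∧ ∀ g, σ g T = T by
    obtain ⟨T, hTC, hT0, hT⟩ := h
    let T' : D := T
    have hinv' : ∀ g v, T'.1 (ρ g v) = T'.1 v := by
      intro g v
      have h := hact g⁻¹ T v
      have h2 : act (π g⁻¹) T = T := hT _
      rw [h2, inv_inv] at h
      exact h.symm
    have hpos : 0 < T'.1 φ := by
      refine lt_of_le_of_ne (hTC φ hS.mem) fun h => hT0 ?_
      exact Subtype.ext (hzero T'.1 hTC fun g => by rw [hinv', ← h])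
    refine ⟨(T'.1 φ)⁻¹ • T'.1, fun v hv => ?_, ?_, fun g v => ?_⟩
    · exact mul_nonneg (inv_nonneg.2 hpos.le) (hTC v hv)
    · exact inv_mul_cancel₀ hpos.ne'
    · simp [hinv']
  refine hG (WeakBilin B) C σ ?_ ?_ ?_ ?_ ?_
  · intro g T hT v hv
    obtain ⟨g, rfl⟩ := hπ g
    exact (hT _ (hS.map_mem g⁻¹ v hv)).trans_eq (hact g T v).symm
  · intro T hT hT0 hT'
    refine hT0 (Subtype.ext (hzero (T : D).1 hT fun g => ?_))
    have := hT' _ (hS.map_mem g φ hS.mem)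
    exact neg_nonneg.1 this
  · rw [isWeaklyComplete_iff_isClosed]
    let ev := WeakBilin.eval B
    -- Continuous functionals on `WeakBilin B` are evaluations at vectors, so the image of the cone
    -- is cut out by closed conditions.
    have e : ((fun (x : WeakBilin B) (l : StrongDual ℝ (WeakBilin B)) => l x) '' (C : Set _)) =
        {F | (∀ l m, F (l + m) = F l + F m) ∧ (∀ (c : ℝ) l, F (c • l) = c * F l) ∧
          ∀ v ∈ P, 0 ≤ F (ev v)} := by
      ext F
      constructor
      · rintro ⟨T, hT, rfl⟩
        exact ⟨fun l m => rfl, fun c l => rfl, fun v hv => hT v hv⟩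
      · rintro ⟨h₁, h₂, h₃⟩
        let T : V →ₗ[ℝ] ℝ :=
          { toFun := fun v => F (ev v)
            map_add' := fun v w => by rw [map_add, h₁]
            map_smul' := fun c v => by rw [map_smul, h₂]; rfl }
        -- Invariance under the kernel is automatic, since `F` sees `v` only through its evaluation
        -- on invariant functionals.
        have hT : T ∈ invariantDual ρ π.ker := fun n hn v => by
          have : ev (ρ n v) = ev v := by
            ext S
            exact (S : D).2 n hn v
          exact congrArg F this
        refine ⟨(⟨T, hT⟩ : D), h₃, funext fun l => ?_⟩
        obtain ⟨v, rfl⟩ := LinearMap.dualEmbedding_surjective B l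
        rfl
    rw [e]
    simp only [Set.ofPred_and, Set.ofPred_forall]
    refine IsClosed.inter ?_ (IsClosed.inter ?_ ?_)
    · exact isClosed_iInter fun l => isClosed_iInter fun m =>
        isClosed_eq (by fun_prop) (by fun_prop)
    · exact isClosed_iInter fun c => isClosed_iInter fun l =>
        isClosed_eq (by fun_prop) (by fun_prop)
    · exact isClosed_iInter fun v => isClosed_iInter fun _ =>
        isClosed_le continuous_const (continuous_apply _)
  · refine ⟨(⟨T₀, hinv⟩ : D), hT₀.nonneg, fun h => ?_, ?_⟩
    · have h' : T₀ = 0 := congrArg (fun T : D => T.1) h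
      have := hT₀.pos
      simp [h'] at this
    · rw [(LinearMap.weakBilin_withSeminorms B).isVonNBounded_iff_seminorm_bounded]
      intro v
      obtain ⟨c, hc⟩ := (hS.dominated v).exists_bound hS.map_mem hT₀.nonneg hM
      -- The seminorm criterion asks for a positive radius and a strict inequality.
      refine ⟨|c| + 1, by positivity, ?_⟩
      rintro _ ⟨g, rfl⟩
      obtain ⟨g, rfl⟩ := hπ g
      have h : (act (π g) (⟨T₀, hinv⟩ : D) : D).1 v = T₀ (ρ g⁻¹ v) := hact g _ v
      change |(act (π g) (⟨T₀, hinv⟩ : D) : D).1 v| < _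
      rw [h]
      linarith [hc g⁻¹, le_abs_self c]
  · refine ⟨WeakBilin.eval B φ, fun l => ?_⟩
    obtain ⟨v, rfl⟩ := LinearMap.dualEmbedding_surjective B l
    obtain ⟨L, h₁, h₂⟩ := hS.dominated v
    have key : ∀ T : WeakBilin B,
        (∑ i : Fin L.length, dualAct σ (π L[i]) (WeakBilin.eval B φ)) T =
          (L.map fun g => (T : D).1 (ρ g φ)).sum := by
      intro T
      rw [← Fin.sum_univ_fun_getElem, sum_apply]
      refine Finset.sum_congr rfl fun i _ => ?_
      have := hact (L[i])⁻¹ T φ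
      rw [map_inv, inv_inv] at this
      exact this
    refine ⟨L.length, fun i => π L[i], fun T hT => ?_, fun T hT => ?_⟩ <;>
      refine le_trans ?_ (key T).ge <;>
      refine le_trans ?_ (abs_le_sum_of_mem h₁ h₂ hT)
    · exact le_abs_self _
    · exact neg_le_abs _

theorem FixedPointPropertyForCones.hasInvariantStates {G : Type u} [Group G]
    (hG : FixedPointPropertyForCones G) : HasInvariantStates G := by
  rintro V _ _ ρ P φ hS ⟨T₀, hT₀⟩
  refine hG.exists_isInvariantState (MonoidHom.id G) Function.surjective_id hS hT₀ ?_
  intro n hn v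
  obtain rfl : n = 1 := hn
  simp

/-- The states live on `E'` ordered by the dual cone: the bounded orbit supplies a bounded state by
evaluation, and weak completeness turns the invariant state back into a point of `C`. -/
theorem HasInvariantStates.fixedPointPropertyForCones {G : Type u} [Group G]
    (hG : HasInvariantStates G) : FixedPointPropertyForCones G := by
  intro E _ _ _ _ _ _ _ C ρ hC _ hw hx hco
  obtain ⟨x₀, hx₀, hne, hb⟩ := hx
  obtain ⟨φ₀, hφ₀⟩ := hco
  let P : PointedCone ℝ (StrongDual ℝ E) :=
    { carrier := {l | ∀ x ∈ C, 0 ≤ l x}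
      add_mem' := fun {l m} hl hm x hx => add_nonneg (hl x hx) (hm x hx)
      zero_mem' := fun x hx => le_rfl
      smul_mem' := fun c l hl x hx => mul_nonneg c.2 (hl x hx) }
  let σ : Representation ℝ G (StrongDual ℝ E) :=
    { toFun := fun g =>
        { toFun := dualAct ρ g
          map_add' := fun _ _ => rfl
          map_smul' := fun _ _ => rfl }
      map_one' := by
        ext l x
        change l (ρ 1⁻¹ x) = l x
        simp
      map_mul' := fun g h => by
        ext l x
        change l (ρ (g * h)⁻¹ x) = l (ρ h⁻¹ (ρ g⁻¹ x))
        simp }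
  have hσ : ∀ g l x, σ g l x = l (ρ g⁻¹ x) := fun _ _ _ => rfl
  -- The form `φ₀` need not be positive. Letting it dominate itself yields `ψ ≥ ±φ₀`, which is
  -- positive and whose translates still dominate every form.
  obtain ⟨n, g, h₁, h₂⟩ := hφ₀ φ₀
  set ψ : StrongDual ℝ E := ∑ i, dualAct ρ (g i) φ₀ with hψ
  have hψ₁ : ∀ x ∈ C, φ₀ x ≤ ψ x := h₁
  have hψ₀ : ∀ x ∈ C, 0 ≤ ψ x := fun x hx => by
    have h₁ := h₁ x hx
    have h₂ : -φ₀ x ≤ ψ x := h₂ x hx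
    linarith
  have hdom : ∀ l : StrongDual ℝ E, ∃ L : List G, ∀ x ∈ C,
      |l x| ≤ (L.map fun g => σ g ψ).sum x := by
    intro l
    obtain ⟨m, k, k₁, k₂⟩ := hφ₀ l
    refine ⟨List.ofFn k, fun x hx => ?_⟩
    have hle : (∑ i, dualAct ρ (k i) φ₀) x ≤ ((List.ofFn k).map fun g => σ g ψ).sum x := by
      rw [List.map_ofFn, List.sum_ofFn, sum_apply, sum_apply]
      exact Finset.sum_le_sum fun i _ => hψ₁ _ (hC _ x hx)
    exact (abs_le.2 ⟨neg_le.1 (k₂ x hx), k₁ x hx⟩).trans hle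
  have hS : IsDominatingSystem σ P ψ := by
    refine ⟨fun g l hl x hx => hl _ (hC _ x hx), hψ₀, fun l => ?_⟩
    obtain ⟨L, hL⟩ := hdom l
    refine ⟨L, fun x hx => ?_, fun x hx => ?_⟩
    · have := abs_le.1 (hL x hx)
      change 0 ≤ (L.map fun g => σ g ψ).sum x + l x
      linarith
    · have := abs_le.1 (hL x hx)
      change 0 ≤ (L.map fun g => σ g ψ).sum x - l x
      linarith
  -- Otherwise domination would force every continuous form to vanish at `x₀`. The base point is
  -- moved to `ρ a x₀` to make evaluation positive at `ψ`.
  obtain ⟨a, ha⟩ : ∃ a, 0 < ψ (ρ a x₀) := by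
    by_contra! hcon
    obtain ⟨l, hl⟩ := SeparatingDual.exists_ne_zero (R := ℝ) hne
    obtain ⟨L, h₁, h₂⟩ := hS.dominated l
    let T : StrongDual ℝ E →ₗ[ℝ] ℝ := (topDualPairing ℝ E).flip x₀
    have := abs_le_length_mul_of_mem h₁ h₂ (T := T) (fun l hl => hl x₀ hx₀) (M := 0)
      fun g _ => hcon g⁻¹
    rw [mul_zero, abs_nonpos_iff] at this
    exact hl this
  have hT₀ : ∃ T, IsBoundedState σ P ψ T := by
    refine ⟨(topDualPairing ℝ E).flip (ρ a x₀), fun l hl => hl _ (hC a x₀ hx₀), ha, ?_⟩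
    have hb' := (NormedSpace.isVonNBounded_iff ℝ).1 (hb.image ψ)
    obtain ⟨M, hM⟩ := hb'.bddAbove
    refine ⟨M, fun g => hM ⟨ρ g⁻¹ (ρ a x₀), ⟨g⁻¹ * a, by simp⟩, rfl⟩⟩
  obtain ⟨T, hT⟩ := hG _ σ P ψ hS hT₀
  obtain ⟨x, hx, hxT⟩ := hw.exists_eval_eq T hT.nonneg
  refine ⟨x, hx, fun h => ?_, fun g => ?_⟩
  · have := hxT ψ
    rw [h, hT.map_eq_one, map_zero] at this
    exact zero_ne_one this
  · by_contra hne
    obtain ⟨l, hl⟩ := SeparatingDual.exists_ne_zero (R := ℝ) (sub_ne_zero.2 hne)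
    apply hl
    have h : l (ρ g x) = σ g⁻¹ l x := by rw [hσ, inv_inv]
    rw [map_sub, h, hxT, hxT, hT.invariant, sub_self]

theorem fixedPointPropertyForCones_iff {G : Type u} [Group G] :
    FixedPointPropertyForCones G ↔ HasInvariantStates G :=
  ⟨fun h => h.hasInvariantStates, fun h => h.fixedPointPropertyForCones⟩

end InvariantStates

/-! ### Dominated vectors and limits of functionals -/

section Dominated

variable {Γ V : Type*} [Group Γ] [AddCommGroup V] [Module ℝ V] {ρ : Representation ℝ Γ V}
  {P : PointedCone ℝ V} {φ : V}

theorem sum_translates_mem (hP : ∀ g, ∀ v ∈ P, ρ g v ∈ P) (hφ : φ ∈ P) (L : List Γ) :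
    (L.map fun g => ρ g φ).sum ∈ P := by
  refine list_sum_mem fun v hv => ?_
  obtain ⟨g, -, rfl⟩ := List.mem_map.1 hv
  exact hP g φ hφ

theorem isDominatedBy_self (hφ : φ ∈ P) : IsDominatedBy ρ P φ φ :=
  ⟨[1], by simpa using add_mem hφ hφ, by simp⟩

variable (ρ P φ) in
/-- The subspace of vectors dominated by `φ`. -/
def dominatedSubmodule (hP : ∀ g, ∀ v ∈ P, ρ g v ∈ P) (hφ : φ ∈ P) : Submodule ℝ V where
  carrier := {v | IsDominatedBy ρ P φ v}
  zero_mem' := ⟨[], by simp, by simp⟩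
  add_mem' := by
    rintro v w ⟨L, h₁, h₂⟩ ⟨M, k₁, k₂⟩
    refine ⟨L ++ M, ?_, ?_⟩
    · convert add_mem h₁ k₁ using 1
      simp only [List.map_append, List.sum_append]
      abel
    · convert add_mem h₂ k₂ using 1
      simp only [List.map_append, List.sum_append]
      abel
  smul_mem' := by
    rintro c v ⟨L, h₁, h₂⟩
    obtain ⟨n, hn⟩ := exists_nat_ge |c|
    have hS := sum_translates_mem hP hφ L
    have e : (((List.replicate n L).flatten).map fun g => ρ g φ).sum =
        (n : ℝ) • (L.map fun g => ρ g φ).sum := by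
      rw [List.map_flatten, List.map_replicate, List.sum_flatten, List.map_replicate,
        List.sum_replicate, Nat.cast_smul_eq_nsmul]
    -- For `n ≥ |c|`, write `n S ± c v = |c| (S ± w) + (n - |c|) S` with `w = v` or `w = -v`
    -- according to the sign of `c`.
    refine ⟨(List.replicate n L).flatten, ?_, ?_⟩ <;> rw [e] <;>
      set S := (L.map fun g => ρ g φ).sum <;>
      rcases le_total 0 c with hc | hc
    · rw [abs_of_nonneg hc] at hn
      convert add_mem (P.smul_mem hc h₁) (P.smul_mem (sub_nonneg.2 hn) hS) using 1
      module
    · rw [abs_of_nonpos hc] at hn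
      convert add_mem (P.smul_mem (neg_nonneg.2 hc) h₂) (P.smul_mem (sub_nonneg.2 hn) hS) using 1
      module
    · rw [abs_of_nonneg hc] at hn
      convert add_mem (P.smul_mem hc h₂) (P.smul_mem (sub_nonneg.2 hn) hS) using 1
      module
    · rw [abs_of_nonpos hc] at hn
      convert add_mem (P.smul_mem (neg_nonneg.2 hc) h₁) (P.smul_mem (sub_nonneg.2 hn) hS) using 1
      module

end Dominated

/-- If `Γ` has invariant states, then a bounded state yields an invariant state on the subspace
of dominated vectors. -/
theorem HasInvariantStates.exists_on_dominated {Γ V : Type u} [Group Γ] [AddCommGroup V]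
    [Module ℝ V] (h : HasInvariantStates Γ) {ρ : Representation ℝ Γ V} {P : PointedCone ℝ V}
    {φ : V} (hP : ∀ g, ∀ v ∈ P, ρ g v ∈ P) (hφ : φ ∈ P) {T₀ : V →ₗ[ℝ] ℝ}
    (hT₀ : IsBoundedState ρ P φ T₀) :
    ∃ T : V →ₗ[ℝ] ℝ, (∀ v ∈ P, IsDominatedBy ρ P φ v → 0 ≤ T v) ∧ T φ = 1 ∧
      ∀ g v, IsDominatedBy ρ P φ v → T (ρ g v) = T v := by
  let W := dominatedSubmodule ρ P φ hP hφ
  have hW : ∀ g, ∀ v ∈ W, ρ g v ∈ W := by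
    rintro g v ⟨L, h₁, h₂⟩
    exact ⟨_, translate_mem hP g h₁ h₂⟩
  let σ : Representation ℝ Γ W :=
    { toFun := fun g => (ρ g).restrict (hW g)
      map_one' := by ext; simp
      map_mul' := fun g h => by ext; simp }
  let φ' : W := ⟨φ, isDominatedBy_self hφ⟩
  have hS : IsDominatingSystem σ (P.comap W.subtype) φ' := by
    refine ⟨fun g v hv => hP g _ hv, hφ, fun v => ?_⟩
    obtain ⟨L, h₁, h₂⟩ := v.2
    have e : W.subtype (L.map fun g => σ g φ').sum = (L.map fun g => ρ g φ).sum := by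
      rw [map_list_sum, List.map_map]
      rfl
    refine ⟨L, ?_, ?_⟩
    · rw [PointedCone.mem_comap, map_add, e]
      exact h₁
    · rw [PointedCone.mem_comap, map_sub, e]
      exact h₂
  obtain ⟨T, hT⟩ := h W σ _ φ' hS ⟨T₀ ∘ₗ W.subtype, fun v hv => hT₀.nonneg _ hv, hT₀.pos,
    hT₀.bounded⟩
  -- The values off the dominated subspace are arbitrary.
  obtain ⟨T', hT'⟩ := T.exists_extend
  have key : ∀ w : W, T' w = T w := fun w => LinearMap.congr_fun hT' w
  refine ⟨T', fun v hv hd => ?_, ?_, fun g v hd => ?_⟩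
  · exact (hT.nonneg ⟨v, hd⟩ hv).trans_eq (key _).symm
  · exact (key φ').trans hT.map_eq_one
  · exact (key (σ g ⟨v, hd⟩)).trans ((hT.invariant g _).trans (key _).symm)

/-- An eventually pointwise bounded family of linear functionals has a pointwise limit along some
ultrafilter. -/
theorem exists_ultrafilter_tendsto_linearMap {ι V : Type*} [AddCommGroup V] [Module ℝ V]
    (F : Filter ι) [F.NeBot] (t : ι → V →ₗ[ℝ] ℝ) (ht : ∀ v, ∃ M, ∀ᶠ i in F, |t i v| ≤ M) :
    ∃ (U : Ultrafilter ι) (T : V →ₗ[ℝ] ℝ), (U : Filter ι) ≤ F ∧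
      ∀ v, Tendsto (fun i => t i v) U (𝓝 (T v)) := by
  have hU := Ultrafilter.of_le F
  set U := Ultrafilter.of F
  have hlim : ∀ v, ∃ c, Tendsto (fun i => t i v) U (𝓝 c) := by
    intro v
    obtain ⟨M, hM⟩ := ht v
    have hmem : (U.map fun i => t i v : Filter ℝ) ≤ 𝓟 (Set.Icc (-M) M) :=
      le_principal_iff.2 (mem_map.2 ((hM.filter_mono hU).mono fun i hi => abs_le.1 hi))
    obtain ⟨c, -, hc⟩ := (isCompact_Icc (a := -M) (b := M)).ultrafilter_le_nhds _ hmem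
    exact ⟨c, hc⟩
  choose T hT using hlim
  refine ⟨U, ⟨⟨T, fun v w => ?_⟩, fun c v => ?_⟩, hU, hT⟩
  · refine tendsto_nhds_unique (hT (v + w)) ?_
    simpa using (hT v).add (hT w)
  · refine tendsto_nhds_unique (hT (c • v)) ?_
    simpa using (hT v).const_mul c

/-! ### Quotients, subgroups, directed unions and finite extensions -/

section Permanence

theorem FixedPointPropertyForCones.of_surjective {G Q : Type u} [Group G] [Group Q] (f : G →* Q)
    (hf : Function.Surjective f) (hG : FixedPointPropertyForCones G) :
    FixedPointPropertyForCones Q := by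
  rw [fixedPointPropertyForCones_iff] at hG ⊢
  rintro V _ _ ρ P φ hS ⟨T₀, hT₀⟩
  have hS' : IsDominatingSystem (ρ.comp f) P φ := by
    refine ⟨fun g => hS.map_mem (f g), hS.mem, fun v => ?_⟩
    obtain ⟨L, h₁, h₂⟩ := hS.dominated v
    have e : ((L.map (Function.surjInv hf)).map fun g => (ρ.comp f) g φ) =
        L.map fun g => ρ g φ := by
      simp [Function.comp_def, Function.surjInv_eq hf]
    exact ⟨L.map (Function.surjInv hf), by rwa [e], by rwa [e]⟩
  obtain ⟨M, hM⟩ := hT₀.bounded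
  obtain ⟨T, hT⟩ := hG V (ρ.comp f) P φ hS' ⟨T₀, hT₀.nonneg, hT₀.pos, M, fun g => hM (f g)⟩
  refine ⟨T, hT.nonneg, hT.map_eq_one, fun g v => ?_⟩
  obtain ⟨g, rfl⟩ := hf g
  exact hT.invariant g v

/-- Induction: `v` is sent to the function `x ↦ T₀ (ρ x⁻¹ v)` on `H`, extended by zero to `G`. This
map `f` is positive and `H`-equivariant, and evaluation at `1` is a bounded state on functions for
`f φ`. A `G`-invariant functional on the functions dominated by `f φ` pulls back to an invariant
state. -/
theorem FixedPointPropertyForCones.subgroup {G : Type u} [Group G]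
    (hG : FixedPointPropertyForCones G) (H : Subgroup G) : FixedPointPropertyForCones H := by
  classical
  rw [fixedPointPropertyForCones_iff] at hG ⊢
  rintro V _ _ ρ P φ hS ⟨T₀, hT₀⟩
  obtain ⟨M, hM⟩ := hT₀.bounded
  let σ : Representation ℝ G (G → ℝ) :=
    { toFun := fun g => LinearMap.funLeft ℝ ℝ (g⁻¹ * ·)
      map_one' := by ext; simp [LinearMap.funLeft_apply]
      map_mul' := fun g h => LinearMap.ext fun u => funext fun x => by
        simp [LinearMap.funLeft_apply, mul_assoc] }
  have hσ : ∀ g u x, σ g u x = u (g⁻¹ * x) := fun _ _ _ => rfl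
  let C : PointedCone ℝ (G → ℝ) :=
    { carrier := {u | ∀ x, 0 ≤ u x}
      add_mem' := fun {u v} hu hv x => add_nonneg (hu x) (hv x)
      zero_mem' := fun x => le_rfl
      smul_mem' := fun c u hu x => mul_nonneg c.2 (hu x) }
  let f : V →ₗ[ℝ] (G → ℝ) := LinearMap.pi fun x =>
    if hx : x ∈ H then T₀ ∘ₗ ρ ⟨x, hx⟩⁻¹ else 0
  have hf₁ : ∀ (x : H) v, f v x = T₀ (ρ x⁻¹ v) := fun x v => by simp [f]
  have hf₂ : ∀ x ∉ H, ∀ v, f v x = 0 := fun x hx v => by simp [f, hx]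
  have hfC : ∀ v ∈ P, f v ∈ C := by
    intro v hv x
    by_cases hx : x ∈ H
    · exact (hT₀.nonneg _ (hS.map_mem _ v hv)).trans_eq (hf₁ ⟨x, hx⟩ v).symm
    · exact (hf₂ x hx v).ge
  have hfσ : ∀ (h : H) v, f (ρ h v) = σ h (f v) := by
    intro h v
    ext x
    rw [hσ]
    by_cases hx : x ∈ H
    · have h₁ := hf₁ ⟨x, hx⟩ (ρ h v)
      have h₂ := hf₁ (h⁻¹ * ⟨x, hx⟩) v
      rw [← Module.End.mul_apply, ← map_mul] at h₁
      rw [mul_inv_rev, inv_inv] at h₂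
      exact h₁.trans h₂.symm
    · rw [hf₂ x hx, hf₂ _ fun hx' => hx ((H.mul_mem_cancel_left (inv_mem h.2)).1 hx')]
  have hfle : ∀ x, f φ x ≤ max M 0 := by
    intro x
    by_cases hx : x ∈ H
    · exact (hf₁ ⟨x, hx⟩ φ).trans_le ((hM _).trans (le_max_left _ _))
    · exact (hf₂ x hx φ).trans_le (le_max_right _ _)
  have hdom : ∀ v, IsDominatedBy σ C (f φ) (f v) := by
    intro v
    obtain ⟨L, h₁, h₂⟩ := hS.dominated v
    have e : ((L.map (H.subtype)).map fun g => σ g (f φ)).sum = f (L.map fun g => ρ g φ).sum := by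
      rw [map_list_sum, List.map_map, List.map_map]
      simp [Function.comp_def, hfσ]
    refine ⟨L.map H.subtype, ?_, ?_⟩
    · rw [e, ← map_add]
      exact hfC _ h₁
    · rw [e, ← map_sub]
      exact hfC _ h₂
  obtain ⟨T, hT₁, hT₂, hT₃⟩ := hG.exists_on_dominated (ρ := σ) (P := C) (φ := f φ)
    (T₀ := LinearMap.proj 1) (fun g u hu x => hu _) (hfC φ hS.mem)
    ⟨fun u hu => hu 1, (by simpa using hT₀.pos : 0 < T₀ (ρ 1⁻¹ φ)).trans_eq (hf₁ 1 φ).symm,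
      max M 0, fun g => hfle _⟩
  refine ⟨T ∘ₗ f, fun v hv => hT₁ _ (hfC v hv) (hdom v), hT₂, fun g v => ?_⟩
  rw [LinearMap.comp_apply, hfσ]
  exact hT₃ _ _ (hdom v)

/-- Translates of `φ` by one subgroup `K` need not dominate everything, so each `K` only gives a
functional on its dominated subspace. Any given vector is dominated using finitely many elements,
hence over all large `K`. -/
theorem FixedPointPropertyForCones.of_directedOn {G : Type u} [Group G] (𝓚 : Set (Subgroup G))
    (hdir : DirectedOn (· ≤ ·) 𝓚) (hcov : ∀ g : G, ∃ K ∈ 𝓚, g ∈ K)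
    (h𝓚 : ∀ K ∈ 𝓚, FixedPointPropertyForCones K) : FixedPointPropertyForCones G := by
  rw [fixedPointPropertyForCones_iff]
  rintro V _ _ ρ P φ hS ⟨T₀, hT₀⟩
  obtain ⟨M, hM⟩ := hT₀.bounded
  have h : ∀ K : 𝓚, ∃ T : V →ₗ[ℝ] ℝ,
      (∀ v ∈ P, IsDominatedBy (ρ.comp K.1.subtype) P φ v → 0 ≤ T v) ∧ T φ = 1 ∧
        ∀ g v, IsDominatedBy (ρ.comp K.1.subtype) P φ v → T (ρ.comp K.1.subtype g v) = T v :=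
    fun K => (h𝓚 K.1 K.2).hasInvariantStates.exists_on_dominated
      (fun g => hS.map_mem g) hS.mem ⟨hT₀.nonneg, hT₀.pos, M, fun g => hM g⟩
  choose t ht₁ ht₂ ht₃ using h
  have : IsDirectedOrder 𝓚 := hdir.isDirectedOrder
  have : Nonempty 𝓚 := by
    obtain ⟨K, hK, -⟩ := hcov 1
    exact ⟨⟨K, hK⟩⟩
  have hmem : ∀ g : G, ∀ᶠ K : 𝓚 in atTop, g ∈ K.1 := by
    intro g
    obtain ⟨K, hK, hg⟩ := hcov g
    exact (eventually_ge_atTop (⟨K, hK⟩ : 𝓚)).mono fun K' hK' => hK' hg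
  have hL : ∀ L : List G, ∀ᶠ K : 𝓚 in atTop, ∃ L' : List K.1, L'.map K.1.subtype = L := by
    intro L
    induction L with
    | nil => exact Eventually.of_forall fun K => ⟨[], rfl⟩
    | cons g L ih =>
      filter_upwards [ih, hmem g] with K ⟨L', hL'⟩ hg
      exact ⟨⟨g, hg⟩ :: L', by rw [List.map_cons, hL']; rfl⟩
  have hdom : ∀ v, ∀ᶠ K : 𝓚 in atTop, IsDominatedBy (ρ.comp K.1.subtype) P φ v := by
    intro v
    obtain ⟨L, h₁, h₂⟩ := hS.dominated v
    refine (hL L).mono ?_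
    rintro K ⟨L', rfl⟩
    rw [List.map_map] at h₁ h₂
    exact ⟨L', h₁, h₂⟩
  obtain ⟨U, T, hU, hT⟩ := exists_ultrafilter_tendsto_linearMap atTop t (by
    intro v
    obtain ⟨L, h₁, h₂⟩ := hS.dominated v
    -- Once `K` contains the elements of `L`, the functional `t K` equals `1` on each of these
    -- translates of `φ`.
    refine ⟨L.length, ?_⟩
    have hi : ∀ g, ∀ᶠ K : 𝓚 in atTop, t K (ρ g φ) = 1 := by
      intro g
      filter_upwards [hmem g] with K hg
      exact (ht₃ K ⟨g, hg⟩ φ (isDominatedBy_self hS.mem)).trans (ht₂ K)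
    have hs : ∀ L : List G, ∀ᶠ K : 𝓚 in atTop, t K (L.map fun g => ρ g φ).sum = L.length := by
      intro L
      induction L with
      | nil => simp
      | cons g L ih =>
        filter_upwards [ih, hi g] with K h h'
        simp [h, h', add_comm]
    filter_upwards [hs L, hdom ((L.map fun g => ρ g φ).sum + v),
      hdom ((L.map fun g => ρ g φ).sum - v)] with K hK k₁ k₂
    have k₁ := ht₁ K _ h₁ k₁
    have k₂ := ht₁ K _ h₂ k₂
    rw [map_add, hK] at k₁
    rw [map_sub, hK] at k₂
    rw [abs_le]
    constructor <;> linarith)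
  refine ⟨T, fun v hv => ?_, ?_, fun g v => ?_⟩
  · exact ge_of_tendsto (hT v) (((hdom v).filter_mono hU).mono fun K hK => ht₁ K v hv hK)
  · refine tendsto_nhds_unique (hT φ) (tendsto_const_nhds.congr fun K => (ht₂ K).symm)
  · refine tendsto_nhds_unique (hT (ρ g v)) ((hT v).congr' ?_)
    filter_upwards [(hdom v).filter_mono hU, (hmem g).filter_mono hU] with K hK hg
    exact (ht₃ K ⟨g, hg⟩ v hK).symm

theorem FixedPointPropertyForCones.of_finite_ker {G Q : Type u} [Group G] [Group Q] (π : G →* Q)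
    (hπ : Function.Surjective π) [Finite π.ker] (hQ : FixedPointPropertyForCones Q) :
    FixedPointPropertyForCones G := by
  rw [fixedPointPropertyForCones_iff]
  rintro V _ _ ρ P φ hS ⟨T₀, hT₀⟩
  obtain ⟨M, hM⟩ := hT₀.bounded
  have := Fintype.ofFinite π.ker
  let T : V →ₗ[ℝ] ℝ := ∑ n : π.ker, T₀ ∘ₗ ρ n
  have hT : ∀ v, T v = ∑ n : π.ker, T₀ (ρ n v) := fun v => by simp [T]
  refine hQ.exists_isInvariantState π hπ hS (T₀ := T) ⟨fun v hv => ?_, ?_, ?_⟩ ?_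
  · rw [hT]
    exact Finset.sum_nonneg fun n _ => hT₀.nonneg _ (hS.map_mem n v hv)
  · rw [hT]
    refine Finset.sum_pos' (fun n _ => hT₀.nonneg _ (hS.map_mem n φ hS.mem))
      ⟨1, Finset.mem_univ _, ?_⟩
    simpa using hT₀.pos
  · refine ⟨∑ _n : π.ker, M, fun g => ?_⟩
    rw [hT]
    refine Finset.sum_le_sum fun n _ => ?_
    simpa using hM (n * g)
  · intro n hn v
    rw [hT, hT]
    refine Fintype.sum_equiv (Equiv.mulRight (⟨n, hn⟩ : π.ker)) _ _ fun m => ?_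
    simp

/-- Summing `φ` over coset representatives gives `ψ`, whose translates by `N` alone dominate all
vectors. The `N`-invariant state so obtained is then summed over the cosets. -/
theorem FixedPointPropertyForCones.of_finite_quotient {N G Q : Type u} [Group N] [Group G]
    [Group Q] [Finite Q] (i : N →* G) (π : G →* Q) (hπ : Function.Surjective π)
    (hi : i.range = π.ker) (hN : FixedPointPropertyForCones N) : FixedPointPropertyForCones G := by
  rw [fixedPointPropertyForCones_iff] at hN ⊢
  rintro V _ _ ρ P φ hS ⟨T₀, hT₀⟩
  obtain ⟨M, hM⟩ := hT₀.bounded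
  have := Fintype.ofFinite Q
  let s : Q → G := Function.surjInv hπ
  have hs : ∀ q, π (s q) = q := Function.surjInv_eq hπ
  have hex : ∀ a b : G, π a = π b → ∃ n, a = i n * b := by
    intro a b hab
    have : a * b⁻¹ ∈ i.range := by simp [hi, MonoidHom.mem_ker, hab]
    obtain ⟨n, hn⟩ := this
    exact ⟨n, by simp [hn]⟩
  let ψ : V := ∑ q, ρ (s q) φ
  have hle : ∀ q, ψ - ρ (s q) φ ∈ P := by
    classical
    intro q
    rw [← Finset.sum_erase_eq_sub (Finset.mem_univ q)]
    exact sum_mem fun r _ => hS.map_mem _ _ hS.mem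
  have hex' : ∀ g, ∃ n, ρ (i n) ψ - ρ g φ ∈ P := by
    intro g
    obtain ⟨n, hn⟩ := hex g (s (π g)) (hs _).symm
    refine ⟨n, ?_⟩
    have h := hS.map_mem (i n) _ (hle (π g))
    rwa [map_sub, ← Module.End.mul_apply (ρ (i n)) (ρ (s _)), ← map_mul, ← hn] at h
  choose k hk using hex'
  have hψ : ψ ∈ P := sum_mem fun q _ => hS.map_mem _ _ hS.mem
  have hS' : IsDominatingSystem (ρ.comp i) P ψ := by
    refine ⟨fun n => hS.map_mem (i n), hψ, fun v => ?_⟩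
    obtain ⟨L, h₁, h₂⟩ := hS.dominated v
    have hL : ((L.map k).map fun n => ρ.comp i n ψ).sum - (L.map fun g => ρ g φ).sum ∈ P := by
      clear h₁ h₂
      induction L with
      | nil => simp
      | cons g L ih =>
        convert add_mem (hk g) ih using 1
        simp only [List.map_cons, List.sum_cons, MonoidHom.comp_apply]
        abel
    refine ⟨L.map k, ?_, ?_⟩
    · convert add_mem hL h₁ using 1
      abel
    · convert add_mem hL h₂ using 1
      abel
  have hψ' : ∀ g, T₀ (ρ g ψ) ≤ ∑ _q : Q, M := by
    intro g
    simp only [ψ, map_sum]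
    refine Finset.sum_le_sum fun q _ => ?_
    simpa using hM (g * s q)
  -- The representative `s 1` need not be `1`. Translating back by it turns `ψ ≥ ρ (s 1) φ` into a
  -- bound below by `φ`.
  have hpos : 0 < T₀ (ρ (s 1)⁻¹ ψ) := by
    have h := hT₀.nonneg _ (hS.map_mem (s 1)⁻¹ _ (hle 1))
    rw [map_sub, map_sub, ← Module.End.mul_apply (ρ (s 1)⁻¹) (ρ (s 1)), ← map_mul,
      inv_mul_cancel, map_one, Module.End.one_apply] at h
    linarith [hT₀.pos]
  obtain ⟨T, hT⟩ := hN V (ρ.comp i) P ψ hS' ⟨T₀ ∘ₗ ρ (s 1)⁻¹,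
    fun v hv => hT₀.nonneg _ (hS.map_mem _ v hv), hpos, ∑ _q : Q, M, fun n => by
      simpa using hψ' ((s 1)⁻¹ * i n)⟩
  have hTeq : ∀ a b : G, π a = π b → ∀ v, T (ρ a v) = T (ρ b v) := by
    intro a b hab v
    obtain ⟨n, rfl⟩ := hex a b hab
    rw [map_mul]
    exact hT.invariant n _
  let T' : V →ₗ[ℝ] ℝ := ∑ q, T ∘ₗ ρ (s q)
  have hT' : ∀ v, T' v = ∑ q, T (ρ (s q) v) := fun v => by simp [T']
  refine ⟨T', fun v hv => ?_, ?_, fun g v => ?_⟩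
  · rw [hT']
    exact Finset.sum_nonneg fun q _ => hT.nonneg _ (hS.map_mem _ v hv)
  -- The sum over cosets of `T` at `φ` is exactly `T ψ`, so no renormalisation is needed.
  · rw [hT', ← hT.map_eq_one, map_sum]
  · rw [hT', hT']
    refine Fintype.sum_equiv (Equiv.mulRight (π g)) _ _ fun q => ?_
    rw [← Module.End.mul_apply, ← map_mul]
    exact hTeq _ _ (by simp [hs]) v

end Permanence

/-! ### Growth series of subexponential and of commutative groups -/

section Growth

open scoped Classical in
/-- All the growth series `∑ |Sⁿ| qⁿ` of the group have radius of convergence at least one. -/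
def HasSummableGrowth (K : Type*) [Group K] : Prop :=
  ∀ S : Finset K, S.Nonempty → ∀ q : ℝ, 0 < q → q < 1 →
    Summable fun n : ℕ => q ^ n * ((S ^ n).card : ℝ)

theorem IsSubexponentialGroup.hasSummableGrowth {K : Type*} [Group K]
    (hK : IsSubexponentialGroup K) : HasSummableGrowth K := by
  classical
  intro S hS q hq₀ hq₁
  obtain ⟨r, hr₁, hr₂⟩ := exists_between ((one_lt_inv₀ hq₀).2 hq₁)
  have hr₀ : 0 < r := one_pos.trans hr₁
  have hqr : q * r < 1 := by
    have := mul_lt_mul_of_pos_left hr₂ hq₀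
    rwa [mul_inv_cancel₀ hq₀.ne'] at this
  refine Summable.of_norm_bounded_eventually_nat
    (summable_geometric_of_lt_one (mul_nonneg hq₀.le hr₀.le) hqr) ?_
  filter_upwards [(hK S hS).eventually_lt_const hr₁, eventually_ge_atTop 1] with n hn hn₁
  rw [← Finset.coe_pow, Set.ncard_coe_finset] at hn
  have hcard : ((S ^ n).card : ℝ) ≤ r ^ n := by
    have h := pow_le_pow_left₀ (by positivity) hn.le n
    rwa [one_div, Real.rpow_inv_natCast_pow (by positivity) (by omega)] at h
  rw [Real.norm_of_nonneg (by positivity), mul_pow]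
  exact mul_le_mul_of_nonneg_left hcard (by positivity)

theorem Finset.exists_prod_pow_of_mem_pow {K : Type*} [CommGroup K] [DecidableEq K] (S : Finset K)
    {n : ℕ} {x : K} (hx : x ∈ S ^ n) : ∃ e : K → ℕ, (∀ s, e s ≤ n) ∧ x = ∏ s ∈ S, s ^ e s := by
  induction n generalizing x with
  | zero => exact ⟨0, fun _ => le_rfl, by simpa using hx⟩
  | succ n ih =>
    rw [pow_succ] at hx
    obtain ⟨y, hy, s, hs, rfl⟩ := Finset.mem_mul.1 hx
    obtain ⟨e, he, rfl⟩ := ih hy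
    refine ⟨e + Pi.single s 1, fun r => add_le_add (he r) ?_, ?_⟩
    · by_cases h : r = s
      · subst h
        simp
      · simp [h]
    · simp only [Pi.add_apply, pow_add, Finset.prod_mul_distrib]
      congr 1
      rw [Finset.prod_eq_single s]
      · simp
      · intro r _ h
        simp [h]
      · exact fun h => absurd hs h

/-- An `n`-fold product depends only on the multiplicity of each element of `S`, which takes one of
`n + 1` values. -/
theorem Finset.card_pow_le_of_comm {K : Type*} [CommGroup K] [DecidableEq K] (S : Finset K)
    (n : ℕ) : (S ^ n).card ≤ (n + 1) ^ S.card := by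
  have hsub : S ^ n ⊆ Finset.univ.image
      fun e : S → Fin (n + 1) => ∏ s : S, (s : K) ^ (e s : ℕ) := by
    intro x hx
    obtain ⟨e, he, rfl⟩ := S.exists_prod_pow_of_mem_pow hx
    refine Finset.mem_image.2 ⟨fun s => ⟨e s, Nat.lt_succ_of_le (he s)⟩, Finset.mem_univ _, ?_⟩
    exact Finset.prod_coe_sort S fun s => s ^ e s
  refine (Finset.card_le_card hsub).trans (Finset.card_image_le.trans ?_)
  simp

theorem hasSummableGrowth_of_comm (K : Type*) [CommGroup K] : HasSummableGrowth K := by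
  classical
  intro S _ q hq₀ hq₁
  have h := (summable_nat_add_iff 1).2 (summable_pow_mul_geometric_of_norm_lt_one S.card
    (r := q) (by rwa [Real.norm_of_nonneg hq₀.le]))
  refine Summable.of_nonneg_of_le (fun n => by positivity) (fun n => ?_) (h.mul_left q⁻¹)
  have hc : ((S ^ n).card : ℝ) ≤ ((n + 1 : ℕ) : ℝ) ^ S.card := by
    exact_mod_cast S.card_pow_le_of_comm n
  calc q ^ n * ((S ^ n).card : ℝ) ≤ q ^ n * ((n + 1 : ℕ) : ℝ) ^ S.card := by gcongr
    _ = q⁻¹ * (((n + 1 : ℕ) : ℝ) ^ S.card * q ^ (n + 1)) := by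
      rw [pow_succ q n]
      field_simp

end Growth

/-! ### Averaging a bounded state over a group of subexponential growth -/

section Averaging

variable {Γ V K : Type*} [Group Γ] [Group K] [AddCommGroup V] [Module ℝ V]
  {ρ : Representation ℝ Γ V} {P : PointedCone ℝ V} {φ : V} {T₀ : V →ₗ[ℝ] ℝ}

open scoped Classical in
theorem IsBoundedState.summable_average (hS : IsDominatingSystem ρ P φ)
    (hT₀ : IsBoundedState ρ P φ T₀) (j : K →* Γ) {S : Finset K} {q : ℝ} (hq₀ : 0 < q)
    (hsum : Summable fun n : ℕ => q ^ n * ((S ^ n).card : ℝ)) (x : Γ) (v : V) :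
    Summable fun n : ℕ => q ^ n * ∑ h ∈ S ^ n, T₀ (ρ (x * j h) v) := by
  obtain ⟨M, hM⟩ := hT₀.bounded
  obtain ⟨c, hc⟩ := (hS.dominated v).exists_bound hS.map_mem hT₀.nonneg hM
  refine Summable.of_norm_bounded (hsum.mul_right c) fun n => ?_
  rw [norm_mul, Real.norm_of_nonneg (by positivity : 0 ≤ q ^ n), mul_assoc]
  refine mul_le_mul_of_nonneg_left ?_ (by positivity)
  refine (norm_sum_le _ _).trans ?_
  rw [← nsmul_eq_mul]
  exact Finset.sum_le_card_nsmul _ _ _ fun h _ => hc _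

open scoped Classical in
/-- Averaging a bounded state over the powers of a finite set `S` gives a functional that is
multiplied by at most `q⁻¹` under `S`, with control along a subgroup commuting with `S`. -/
theorem IsBoundedState.exists_almost_invariant (hS : IsDominatingSystem ρ P φ)
    (hT₀ : IsBoundedState ρ P φ T₀) (A : Subgroup Γ) (j : K →* Γ)
    (hcomm : ∀ a ∈ A, ∀ h, a * j h = j h * a) {S : Finset K} {q : ℝ} (hq₀ : 0 < q)
    (hsum : Summable fun n : ℕ => q ^ n * ((S ^ n).card : ℝ)) :
    ∃ T : V →ₗ[ℝ] ℝ, (∀ v ∈ P, 0 ≤ T v) ∧ T φ = 1 ∧ (∀ a ∈ A, T (ρ a φ) ≤ 2) ∧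
      ∀ s ∈ S, ∀ v ∈ P, q * T (ρ (j s) v) ≤ T v := by
  have hs := hT₀.summable_average hS j hq₀ hsum
  obtain ⟨M, hM⟩ := hT₀.bounded
  obtain ⟨F, hF⟩ : ∃ F : Γ → V →ₗ[ℝ] ℝ, ∀ x v,
      F x v = ∑' n : ℕ, q ^ n * ∑ h ∈ S ^ n, T₀ (ρ (x * j h) v) := by
    refine ⟨fun x =>
      { toFun := fun v => ∑' n : ℕ, q ^ n * ∑ h ∈ S ^ n, T₀ (ρ (x * j h) v)
        map_add' := fun v w => ?_
        map_smul' := fun c v => ?_ }, fun _ _ => rfl⟩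
    · rw [← (hs x v).tsum_add (hs x w)]
      simp only [map_add, Finset.sum_add_distrib, mul_add]
    · rw [RingHom.id_apply, smul_eq_mul, ← tsum_mul_left]
      simp only [map_smul, smul_eq_mul, ← Finset.mul_sum, mul_left_comm]
  have hterm : ∀ x, ∀ v ∈ P, ∀ n : ℕ, 0 ≤ q ^ n * ∑ h ∈ S ^ n, T₀ (ρ (x * j h) v) :=
    fun x v hv n => mul_nonneg (by positivity)
      (Finset.sum_nonneg fun h _ => hT₀.nonneg _ (hS.map_mem _ v hv))
  have hFnonneg : ∀ x, ∀ v ∈ P, 0 ≤ F x v := fun x v hv => by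
    rw [hF]
    exact tsum_nonneg (hterm x v hv)
  have hFpos : 0 < F 1 φ := by
    rw [hF]
    refine (hs 1 φ).tsum_pos (hterm 1 φ hS.mem) 0 ?_
    rw [pow_zero, pow_zero, ← Finset.singleton_one, Finset.sum_singleton]
    simpa using hT₀.pos
  have hFbdd : ∀ x, F x φ ≤ ∑' n : ℕ, q ^ n * ((S ^ n).card : ℝ) * M := by
    intro x
    rw [hF]
    refine (hs x φ).tsum_le_tsum (fun n => ?_) (hsum.mul_right M)
    rw [mul_assoc, ← nsmul_eq_mul ((S ^ n).card)]
    exact mul_le_mul_of_nonneg_left (Finset.sum_le_card_nsmul _ _ _ fun h _ => hM _)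
      (by positivity)
  have hFmul : ∀ x, ∀ a ∈ A, F x (ρ a φ) = F (x * a) φ := by
    intro x a ha
    simp only [hF, ← Module.End.mul_apply, ← map_mul, mul_assoc, hcomm a ha]
  -- Right multiplication by `s` embeds `Sⁿ` in `Sⁿ⁺¹`, so the left side is at most the series for
  -- `F x v` without its term of index zero.
  have hFs : ∀ x, ∀ s ∈ S, ∀ v ∈ P, q * F x (ρ (j s) v) ≤ F x v := by
    intro x s hsS v hv
    rw [hF, hF, ← tsum_mul_left, (hs x v).tsum_eq_zero_add]
    refine le_trans ?_ (le_add_of_nonneg_left (hterm x v hv 0))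
    refine Summable.tsum_le_tsum (fun n => ?_) ((hs x (ρ (j s) v)).mul_left q)
      ((summable_nat_add_iff (f := fun n => q ^ n * ∑ h ∈ S ^ n, T₀ (ρ (x * j h) v)) 1).2 (hs x v))
    rw [← mul_assoc, ← pow_succ']
    refine mul_le_mul_of_nonneg_left ?_ (by positivity)
    have e : ∑ h ∈ S ^ n, T₀ (ρ (x * j h) (ρ (j s) v)) =
        ∑ h ∈ (S ^ n).image (· * s), T₀ (ρ (x * j h) v) := by
      rw [Finset.sum_image fun _ _ _ _ h => mul_right_cancel h]
      simp only [← Module.End.mul_apply, ← map_mul, mul_assoc]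
    rw [e]
    refine Finset.sum_le_sum_of_subset_of_nonneg ?_
      fun h _ _ => hT₀.nonneg _ (hS.map_mem _ v hv)
    refine Finset.image_subset_iff.2 fun h hh => ?_
    rw [pow_succ]
    exact Finset.mul_mem_mul hh hsS
  -- Translating by `A` only moves the base point of `F`. Starting within a factor `2` of the
  -- supremum over `A` gives, after normalisation, a bound on the `A`-orbit of `φ` independent of
  -- `S` and `q`.
  obtain ⟨a, ha⟩ : ∃ a : A, ∀ b : A, F b φ ≤ 2 * F a φ ∧ 0 < F a φ := by
    have hbdd : BddAbove (Set.range fun a : A => F a φ) := by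
      refine ⟨∑' n : ℕ, q ^ n * ((S ^ n).card : ℝ) * M, ?_⟩
      rintro _ ⟨a, rfl⟩
      exact hFbdd a
    have hsup : 0 < ⨆ a : A, F a φ := hFpos.trans_le (le_ciSup hbdd 1)
    obtain ⟨a, ha⟩ := exists_lt_of_lt_ciSup (half_lt_self hsup)
    refine ⟨a, fun b => ⟨?_, (half_pos hsup).trans ha⟩⟩
    have := le_ciSup hbdd b
    linarith
  have ha₀ : 0 < F a φ := (ha 1).2
  refine ⟨(F a φ)⁻¹ • F a, fun v hv => ?_, ?_, fun b hb => ?_, fun s hsS v hv => ?_⟩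
  · exact mul_nonneg (inv_nonneg.2 ha₀.le) (hFnonneg a v hv)
  · exact inv_mul_cancel₀ ha₀.ne'
  · rw [LinearMap.smul_apply, hFmul a b hb, smul_eq_mul, inv_mul_le_iff₀ ha₀, mul_comm]
    exact (ha (a * ⟨b, hb⟩)).1
  · rw [LinearMap.smul_apply, LinearMap.smul_apply, smul_eq_mul, smul_eq_mul, mul_left_comm]
    exact mul_le_mul_of_nonneg_left (hFs a s hsS v hv) (inv_nonneg.2 ha₀.le)

/-- If a group is the product of a subgroup and a commuting homomorphic image of a group of
subexponential growth, then a bounded state can be made invariant under the latter. -/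
theorem IsBoundedState.exists_invariant_of_commuting (hS : IsDominatingSystem ρ P φ)
    (hT₀ : IsBoundedState ρ P φ T₀) (A : Subgroup Γ) (j : K →* Γ)
    (hcomm : ∀ a ∈ A, ∀ h, a * j h = j h * a) (hprod : ∀ g, ∃ a ∈ A, ∃ h, g = a * j h)
    (hK : HasSummableGrowth K) :
    ∃ T : V →ₗ[ℝ] ℝ, IsBoundedState ρ P φ T ∧ ∀ h v, T (ρ (j h) v) = T v := by
  classical
  -- These ratios tend to `1` and stay at least `1/2`, so the bound `2` along `A` becomes at most
  -- `4` on the whole orbit.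
  let q (k : ℕ) : ℝ := 1 - ((k : ℝ) + 2)⁻¹
  have hinv : ∀ k : ℕ, ((k : ℝ) + 2)⁻¹ ≤ 2⁻¹ := fun k =>
    inv_anti₀ two_pos (by linarith [k.cast_nonneg (α := ℝ)])
  have hq : ∀ k, 2⁻¹ ≤ q k := fun k => by
    have := hinv k
    simp only [q]
    linarith
  have hq₀ : ∀ k, 0 < q k := fun k => lt_of_lt_of_le (by norm_num) (hq k)
  have hq₁ : ∀ k, q k < 1 := fun k => sub_lt_self _ (by positivity)
  have hqlim : Tendsto q atTop (𝓝 1) := by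
    have h : Tendsto (fun k : ℕ => ((k : ℝ) + 2)⁻¹) atTop (𝓝 0) :=
      tendsto_inv_atTop_zero.comp (tendsto_natCast_atTop_atTop.atTop_add tendsto_const_nhds)
    simpa using h.const_sub 1
  have hex : ∀ i : Finset K × ℕ, ∃ T : V →ₗ[ℝ] ℝ, (∀ v ∈ P, 0 ≤ T v) ∧ T φ = 1 ∧
      (∀ a ∈ A, T (ρ a φ) ≤ 2) ∧
      ∀ s ∈ insert 1 i.1, ∀ v ∈ P, q i.2 * T (ρ (j s) v) ≤ T v := fun i =>
    hT₀.exists_almost_invariant hS A j hcomm (hq₀ i.2)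
      (hK _ (Finset.insert_nonempty _ _) _ (hq₀ i.2) (hq₁ i.2))
  choose t ht₀ ht₁ ht₂ ht₃ using hex
  have hev : ∀ h : K, ∀ᶠ i : Finset K × ℕ in atTop, h ∈ insert 1 i.1 := by
    intro h
    filter_upwards [eventually_ge_atTop (({h}, 0) : Finset K × ℕ)] with i hi
    exact Finset.mem_insert_of_mem (hi.1 (Finset.mem_singleton_self h))
  have hbd : ∀ g, ∀ᶠ i : Finset K × ℕ in atTop, t i (ρ g φ) ≤ 4 := by
    intro g
    obtain ⟨a, ha, h, rfl⟩ := hprod g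
    filter_upwards [hev h] with i hi
    have h₁ := ht₃ i h hi _ (hS.map_mem a φ hS.mem)
    have h₂ := ht₀ i _ (hS.map_mem (j h * a) φ hS.mem)
    rw [← Module.End.mul_apply, ← map_mul] at h₁
    rw [hcomm a ha]
    nlinarith [ht₂ i a ha, hq i.2]
  obtain ⟨U, T, hU, hT⟩ := exists_ultrafilter_tendsto_linearMap atTop t (by
    intro v
    obtain ⟨L, h₁, h₂⟩ := hS.dominated v
    refine ⟨L.length * 4, ?_⟩
    have hall : ∀ᶠ i : Finset K × ℕ in atTop, ∀ g ∈ {g | g ∈ L}, t i (ρ g φ) ≤ 4 :=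
      (eventually_all_finite L.finite_toSet).2 fun g _ => hbd g
    exact hall.mono fun i hi => abs_le_length_mul_of_mem h₁ h₂ (ht₀ i) hi)
  have hTnonneg : ∀ v ∈ P, 0 ≤ T v := fun v hv =>
    ge_of_tendsto' (hT v) fun i => ht₀ i v hv
  have hTφ : T φ = 1 :=
    tendsto_nhds_unique (hT φ) (tendsto_const_nhds.congr fun i => (ht₁ i).symm)
  have hTle : ∀ h, ∀ v ∈ P, T (ρ (j h) v) ≤ T v := by
    intro h v hv
    have hq' : Tendsto (fun i : Finset K × ℕ => q i.2) U (𝓝 1) :=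
      (hqlim.comp (tendsto_snd.mono_left prod_atTop_atTop_eq.ge)).mono_left hU
    have hlim := hq'.mul (hT (ρ (j h) v))
    rw [one_mul] at hlim
    exact le_of_tendsto_of_tendsto hlim (hT v)
      (((hev h).filter_mono hU).mono fun i hi => ht₃ i h hi v hv)
  -- The inequality for `h⁻¹` at the translated vector is the reverse one.
  have hTeq : ∀ h, ∀ v ∈ P, T (ρ (j h) v) = T v := by
    intro h v hv
    refine le_antisymm (hTle h v hv) ?_
    have := hTle h⁻¹ _ (hS.map_mem (j h) v hv)
    rwa [← Module.End.mul_apply, ← map_mul, ← map_mul, inv_mul_cancel, map_one, map_one,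
      Module.End.one_apply] at this
  -- Every vector is half the difference of the two positive vectors given by domination.
  have hTinv : ∀ h v, T (ρ (j h) v) = T v := by
    intro h v
    obtain ⟨L, h₁, h₂⟩ := hS.dominated v
    have h₁ := hTeq h _ h₁
    have h₂ := hTeq h _ h₂
    simp only [map_add, map_sub] at h₁ h₂
    linarith
  refine ⟨T, ⟨hTnonneg, by rw [hTφ]; exact one_pos, 2, fun g => ?_⟩, hTinv⟩
  obtain ⟨a, ha, h, rfl⟩ := hprod g
  rw [hcomm a ha, map_mul, Module.End.mul_apply, hTinv]
  exact le_of_tendsto' (hT _) fun i => ht₂ i a ha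

end Averaging

/-! ### Products with subexponential groups and central extensions -/

section CentralExtensions

/-- Common source of both cases: for `G × H`, the subgroup `A` is the factor `G` and `K` is `H`; for
a central extension, `A` is the whole group and `K` is the kernel `N`, which is commutative and so
has polynomial growth. -/
theorem FixedPointPropertyForCones.of_commuting {Γ Q K : Type u} [Group Γ] [Group Q] [Group K]
    (hQ : FixedPointPropertyForCones Q) (π : Γ →* Q) (hπ : Function.Surjective π)
    (A : Subgroup Γ) (j : K →* Γ) (hker : π.ker ≤ j.range)
    (hcomm : ∀ a ∈ A, ∀ h, a * j h = j h * a) (hprod : ∀ g, ∃ a ∈ A, ∃ h, g = a * j h)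
    (hK : HasSummableGrowth K) : FixedPointPropertyForCones Γ := by
  rw [fixedPointPropertyForCones_iff]
  rintro V _ _ ρ P φ hS ⟨T₀, hT₀⟩
  obtain ⟨T, hT, hTinv⟩ := hT₀.exists_invariant_of_commuting hS A j hcomm hprod hK
  refine hQ.exists_isInvariantState π hπ hS hT fun n hn v => ?_
  obtain ⟨h, rfl⟩ := hker hn
  exact hTinv h v

theorem FixedPointPropertyForCones.prod {G H : Type u} [Group G] [Group H]
    (hG : FixedPointPropertyForCones G) (hH : IsSubexponentialGroup H) :
    FixedPointPropertyForCones (G × H) := by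
  refine hG.of_commuting (MonoidHom.fst G H) Prod.fst_surjective (MonoidHom.inl G H).range
    (MonoidHom.inr G H) ?_ ?_ ?_ hH.hasSummableGrowth
  · rintro ⟨g, h⟩ hg
    obtain rfl : g = 1 := hg
    exact ⟨h, rfl⟩
  · rintro _ ⟨g, rfl⟩ h
    simp
  · rintro ⟨g, h⟩
    exact ⟨(g, 1), ⟨g, rfl⟩, h, by simp⟩

theorem FixedPointPropertyForCones.of_central {N G Q : Type u} [Group N] [Group G] [Group Q]
    (S : GroupExtension N G Q) (hS : S.inl.range ≤ Subgroup.center G)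
    (hQ : FixedPointPropertyForCones Q) : FixedPointPropertyForCones G := by
  have hc : ∀ (n : N) (g : G), g * S.inl n = S.inl n * g := fun n g =>
    Subgroup.mem_center_iff.1 (hS ⟨n, rfl⟩) g
  let _ : CommGroup N :=
    { mul_comm := fun m n => S.inl_injective (by rw [map_mul, map_mul, hc]) }
  exact hQ.of_commuting S.rightHom S.rightHom_surjective ⊤ S.inl
    S.range_inl_eq_ker_rightHom.ge (fun a _ h => hc h a)
    (fun g => ⟨g, Subgroup.mem_top g, 1, by simp⟩) (hasSummableGrowth_of_comm N)

end CentralExtensions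

theorem mainTheorem4 :
    -- quotients
    (∀ (G Q : Type u) [Group G] [Group Q] (f : G →* Q), Function.Surjective f →
      FixedPointPropertyForCones G → FixedPointPropertyForCones Q) ∧
    -- subgroups
    (∀ (G : Type u) [Group G] (H : Subgroup G),
      FixedPointPropertyForCones G → FixedPointPropertyForCones H) ∧
    -- directed unions
    (∀ (G : Type u) [Group G] (𝓚 : Set (Subgroup G)), DirectedOn (· ≤ ·) 𝓚 →
      (∀ g : G, ∃ K ∈ 𝓚, g ∈ K) → (∀ K ∈ 𝓚, FixedPointPropertyForCones K) →
      FixedPointPropertyForCones G) ∧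
    -- Cartesian products with subexponential groups
    (∀ (G H : Type u) [Group G] [Group H], FixedPointPropertyForCones G →
      IsSubexponentialGroup H → FixedPointPropertyForCones (G × H)) ∧
    -- central extensions
    (∀ (N G Q : Type u) [Group N] [Group G] [Group Q] (S : GroupExtension N G Q),
      S.inl.range ≤ Subgroup.center G →
      FixedPointPropertyForCones Q → FixedPointPropertyForCones G) ∧
    -- extensions of a group with the property by a finite group (finite kernel)
    (∀ (N G Q : Type u) [Group N] [Group G] [Group Q], GroupExtension N G Q → Finite N →
      FixedPointPropertyForCones Q → FixedPointPropertyForCones G) ∧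
    -- extensions of a finite group by a group with the property (finite quotient)
    (∀ (N G Q : Type u) [Group N] [Group G] [Group Q], GroupExtension N G Q → Finite Q →
      FixedPointPropertyForCones N → FixedPointPropertyForCones G) := by

  refine ⟨fun G Q _ _ f hf hG => hG.of_surjective f hf, fun G _ H hG => hG.subgroup H,
    fun G _ 𝓚 hdir hcov h𝓚 => .of_directedOn 𝓚 hdir hcov h𝓚, fun G H _ _ hG hH => hG.prod hH,
    fun N G Q _ _ _ S hS hQ => .of_central S hS hQ, fun N G Q _ _ _ S _ hQ => ?_,
    fun N G Q _ _ _ S _ hN => ?_⟩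
  · have : Finite S.rightHom.ker := by
      rw [← S.range_inl_eq_ker_rightHom]
      exact Finite.of_surjective S.inl.rangeRestrict S.inl.rangeRestrict_surjective
    exact hQ.of_finite_ker S.rightHom S.rightHom_surjective
  · exact hN.of_finite_quotient S.inl S.rightHom S.rightHom_surjective S.range_inl_eq_ker_rightHom
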